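/- For complex numbers $a, a_1,\dots,a_m$ and $q$ with $|q|<1$ write $(a;q)_\infty=\prod_{n=0}^{\infty}(1-aq^n)$ and $(a_1,\dots,a_m;q)_\infty=(a_1;q)_\infty\cdots(a_m;q)_\infty$. Let $h_1(n)$ be the coefficients of the power series expansion $$(-q^2,-q^3;q^5)_\infty^2\,(q^2,q^8;q^{10})_\infty=\sum_{n=0}^{\infty}h_1(n)q^n,\qquad |q|<1,$$ and put $H_r(q)=\sum_{n=0}^{\infty}h_1(5n+r)q^n$ for $0\le r\le 4$ and $|q|<1$. Then $h_1(5n+1)=0$ for all $n\ge 0$, and for all $|q|<1$ $$(-q^2,-q^3;q^5)_\infty^2\,(q^2,q^8;q^{10})_\infty=H_0(q^5)+q^2H_2(q^5)+q^3H_3(q^5)+q^4H_4(q^5),$$ where $$H_0(q)=\frac{1}{(q,q^4;q^5)_\infty^2\,(q^2,q^8;q^{10})_\infty},\qquad H_2(q)=\frac{1}{(q^2,q^3;q^5)_\infty^2\,(q^2,q^8;q^{10})_\infty},$$ $$H_3(q)=\frac{2}{(q,q^2,q^3,q^4;q^5)_\infty\,(q^4,q^6;q^{10})_\infty},\qquad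 H_4(q)=\frac{-1}{(q^2,q^3;q^5)_\infty^2\,(q^4,q^6;q^{10})_\infty}.$$ -/

import Mathlib

namespace QDissection

/-- The infinite product `(a; q)_∞ = ∏_{n ≥ 0} (1 - a q ^ n)`, for `‖q‖ < 1`. -/
noncomputable def qPoch (a q : ℂ) : ℂ := ∏' n : ℕ, (1 - a * q ^ n)

/-- The product `(a₁, …, aₘ; q)_∞ = (a₁; q)_∞ ⋯ (aₘ; q)_∞`. -/
noncomputable def qPochs (as : List ℂ) (q : ℂ) : ℂ := (as.map fun a => qPoch a q).prod

/-- For `‖q‖ < 1` the product defining `(a; q)_∞` converges, so `qPoch` is its value. -/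
theorem qPoch_multipliable (a : ℂ) {q : ℂ} (hq : ‖q‖ < 1) :
    Multipliable fun n : ℕ => 1 - a * q ^ n := by
  simp only [sub_eq_add_neg]
  apply multipliable_one_add_of_summable
  simp only [norm_neg, norm_mul, norm_pow]
  exact (summable_geometric_of_lt_one (norm_nonneg q) hq).mul_left _

/-- For `‖a‖ < 1` and `‖q‖ < 1` one has `(a; q)_∞ ≠ 0`, so reciprocals are genuine. -/
theorem qPoch_ne_zero {a q : ℂ} (ha : ‖a‖ < 1) (hq : ‖q‖ < 1) : qPoch a q ≠ 0 := by
  unfold qPoch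
  simp only [sub_eq_add_neg]
  apply tprod_one_add_ne_zero_of_summable
  · intro n hn
    have h1 : a * q ^ n = 1 := by linear_combination -hn
    have h2 : ‖a‖ * ‖q‖ ^ n = 1 := by rw [← norm_pow, ← norm_mul, h1, norm_one]
    have h3 : ‖q‖ ^ n ≤ 1 := pow_le_one₀ (norm_nonneg q) hq.le
    nlinarith [norm_nonneg a, norm_nonneg q, pow_nonneg (norm_nonneg q) n]
  · simp only [norm_neg, norm_mul, norm_pow]
    exact (summable_geometric_of_lt_one (norm_nonneg q) hq).mul_left _

/-- The function `(-q², -q³; q⁵)_∞² (q², q⁸; q¹⁰)_∞` of `q`. -/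
noncomputable def F (q : ℂ) : ℂ :=
  qPochs [-q ^ 2, -q ^ 3] (q ^ 5) ^ 2 * qPochs [q ^ 2, q ^ 8] (q ^ 10)

/-- `h₁(n)`, the coefficient of `q ^ n` in the power series expansion of `F` about `q = 0`. -/
noncomputable def h₁ (n : ℕ) : ℂ := iteratedDeriv n F 0 / (n.factorial : ℂ)

/-- The generating function `H_r(q) = ∑_{n ≥ 0} h₁(5 n + r) q ^ n`. -/
noncomputable def H (r : ℕ) (q : ℂ) : ℂ := ∑' n : ℕ, h₁ (5 * n + r) * q ^ n

end QDissection

/-! Put `p ^ 2 = q` and `Q = q ^ 5`. By the Jacobi triple product, `F q` times `(Q; Q)² (Q²; Q²)`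
(infinite products) is `theta 0 5 1 p ^ 2 * theta 1 5 3 q`, and the same factor turns each claimed
component into a product of three theta series in `Q` and `p ^ 5`. The dissection thus becomes the
theta identity `theta_dissection`.

Splitting `theta 0 5 1 p ^ 2` by the parity of the index sum produces the factors `theta 0 5 0 q`
and `theta 0 5 5 q`, which are already series in `Q`. The remaining products, `theta 0 5 1 q * theta
1 5 3 q` and `theta 0 5 4 q * theta 1 5 3 q`, are double series, summed over the cosets of an
index-five lattice on which `x² + y²` becomes `5 (u² + v²)`. In both, the coset that would feed
residue 1 carries the factor `theta 1 25 25 q = 0`; hence `h₁ (5 n + 1) = 0`.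

Matching the other residues takes `theta_level_one_five_det` and the two cross relations. The
determinant comes from another lattice rearrangement. Each cross relation, multiplied by a companion
with some signs changed, gives zero; both are holomorphic on the disc and the companion is nonzero
at the origin, so the relation itself vanishes.

The components are holomorphic on the disc, so uniqueness of Taylor coefficients identifies them
with the `H r`. -/

open Filter Topology

namespace QDissection

/-! ### The Jacobi triple product -/

/-- The reciprocal of `(1 - q) ⋯ (1 - q ^ k)`, extended by `0` to negative `k`. -/
noncomputable def recipPoch (q : ℂ) (k : ℤ) : ℂ :=
  if 0 ≤ k then (∏ i ∈ Finset.range k.toNat, (1 - q ^ (i + 1)))⁻¹ else 0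

lemma one_sub_pow_succ_ne_zero {q : ℂ} (hq : ‖q‖ < 1) (i : ℕ) : 1 - q ^ (i + 1) ≠ 0 := by
  intro h
  have h1 : ‖q ^ (i + 1)‖ = 1 := by rw [← sub_eq_zero.mp h, norm_one]
  rw [norm_pow] at h1
  exact absurd h1 (pow_lt_one₀ (norm_nonneg q) hq (Nat.succ_ne_zero i)).ne

lemma recipPoch_natCast (q : ℂ) (k : ℕ) :
    recipPoch q k = (∏ i ∈ Finset.range k, (1 - q ^ (i + 1)))⁻¹ := by
  simp [recipPoch]

lemma recipPoch_of_neg (q : ℂ) {k : ℤ} (hk : k < 0) : recipPoch q k = 0 := by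
  simp [recipPoch, hk.not_ge]

/-- At `k = -1` the factor `1 - q ^ 0` vanishes, so extension by zero keeps the recursion valid on
all of `ℤ` and the edges of the finite triple product need no special treatment. -/
lemma recipPoch_pred {q : ℂ} (hq : ‖q‖ < 1) (k : ℤ) :
    recipPoch q k = (1 - q ^ (k + 1)) * recipPoch q (k + 1) := by
  rcases lt_trichotomy k (-1) with hk | rfl | hk
  · rw [recipPoch_of_neg q (by omega), recipPoch_of_neg q (by omega), mul_zero]
  · rw [recipPoch_of_neg q (by omega)]; simp
  · obtain ⟨n, rfl⟩ := Int.eq_ofNat_of_zero_le (show 0 ≤ k by omega)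
    have h := recipPoch_natCast q (n + 1)
    push_cast at h
    have hz : q ^ ((n : ℤ) + 1) = q ^ (n + 1) := by exact_mod_cast zpow_natCast q (n + 1)
    rw [h, recipPoch_natCast, Finset.prod_range_succ, mul_inv, hz,
      mul_left_comm, mul_inv_cancel₀ (one_sub_pow_succ_ne_zero hq n), mul_one]

/-- The coefficient `(q)_{2N} / ((q)_{N-n} (q)_{N+n})` of the finite triple product. -/
noncomputable def centralCoeff (q : ℂ) (N : ℕ) (n : ℤ) : ℂ :=
  (∏ i ∈ Finset.range (2 * N), (1 - q ^ (i + 1))) * recipPoch q (N - n) * recipPoch q (N + n)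

/-- Comparison of coefficients of `z ^ n` when the finite product acquires the factor `(1 + z p ^
(2N+1)) (1 + z⁻¹ p ^ (2N+1))`. All reciprocals are reduced to those at `N - n + 1` and `N + n + 1`.
-/
lemma centralCoeff_succ {p : ℂ} (hp0 : p ≠ 0) (hp : ‖p‖ < 1) (N : ℕ) (n : ℤ) :
    centralCoeff (p ^ 2) (N + 1) n * p ^ (n ^ 2) =
      (1 + p ^ (2 * N + 1) * p ^ (2 * N + 1)) * (centralCoeff (p ^ 2) N n * p ^ (n ^ 2)) +
      p ^ (2 * N + 1) * (centralCoeff (p ^ 2) N (n - 1) * p ^ ((n - 1) ^ 2)) +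
      p ^ (2 * N + 1) * (centralCoeff (p ^ 2) N (n + 1) * p ^ ((n + 1) ^ 2)) := by
  have hq : ‖p ^ 2‖ < 1 := by
    rw [norm_pow]; exact pow_lt_one₀ (norm_nonneg p) hp two_ne_zero
  have hQ0 : p ^ 2 ≠ 0 := pow_ne_zero 2 hp0
  unfold centralCoeff
  have e1 : (N : ℤ) - (n - 1) = N - n + 1 := by ring
  have e2 : (N : ℤ) + (n + 1) = N + n + 1 := by ring
  have e3 : ((N + 1 : ℕ) : ℤ) - n = N - n + 1 := by push_cast; ring
  have e4 : ((N + 1 : ℕ) : ℤ) + n = N + n + 1 := by push_cast; ring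
  have a1 := recipPoch_pred hq ((N : ℤ) - n)
  have a2 := recipPoch_pred hq ((N : ℤ) - (n + 1))
  have b1 := recipPoch_pred hq ((N : ℤ) + n)
  have b2 := recipPoch_pred hq ((N : ℤ) + (n - 1))
  have f1 : (N : ℤ) - (n + 1) + 1 = N - n := by ring
  have f2 : (N : ℤ) + (n - 1) + 1 = N + n := by ring
  rw [f1, a1] at a2
  rw [f2, b1] at b2
  rw [e1, e2, e3, e4, a1, a2, b1, b2, show 2 * (N + 1) = 2 * N + 1 + 1 by ring,
    Finset.prod_range_succ, Finset.prod_range_succ]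
  generalize recipPoch (p ^ 2) (N - n + 1) = R1
  generalize recipPoch (p ^ 2) (N + n + 1) = R2
  generalize (∏ i ∈ Finset.range (2 * N), (1 - (p ^ 2) ^ (i + 1))) = P
  have g1 : (p ^ 2) ^ ((N : ℤ) - n + 1) = (p ^ 2) ^ ((N : ℤ) - n) * p ^ 2 := zpow_add_one₀ hQ0 _
  have g2 : (p ^ 2) ^ ((N : ℤ) + n + 1) = (p ^ 2) ^ ((N : ℤ) + n) * p ^ 2 := zpow_add_one₀ hQ0 _
  have zz : ∀ k : ℤ, (p ^ 2) ^ k = p ^ (2 * k) := fun k => by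
    rw [zpow_mul]; norm_cast
  have h1 : p ^ (2 * N + 1) * p ^ ((n - 1) ^ 2) = (p ^ 2) ^ ((N : ℤ) - n) * p ^ 2 * p ^ (n ^ 2) := by
    rw [zz, ← zpow_natCast p (2 * N + 1), ← zpow_natCast p 2, ← zpow_add₀ hp0, ← zpow_add₀ hp0,
      ← zpow_add₀ hp0]
    congr 1; push_cast; ring
  have h2 : p ^ (2 * N + 1) * p ^ ((n + 1) ^ 2) = (p ^ 2) ^ ((N : ℤ) + n) * p ^ 2 * p ^ (n ^ 2) := by
    rw [zz, ← zpow_natCast p (2 * N + 1), ← zpow_natCast p 2, ← zpow_add₀ hp0, ← zpow_add₀ hp0,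
      ← zpow_add₀ hp0]
    congr 1; push_cast; ring
  have h3 : (p ^ 2) ^ (2 * N) = (p ^ 2) ^ ((N : ℤ) - n) * (p ^ 2) ^ ((N : ℤ) + n) := by
    rw [← zpow_natCast (p ^ 2) (2 * N), ← zpow_add₀ hQ0]
    congr 1; push_cast; ring
  have h4 : (p ^ 2) ^ (2 * N + 1) = (p ^ 2) ^ ((N : ℤ) - n) * (p ^ 2) ^ ((N : ℤ) + n) * p ^ 2 := by
    rw [pow_succ, h3]
  have h5 : (p ^ 2) ^ (2 * N + 1 + 1) =
      (p ^ 2) ^ ((N : ℤ) - n) * (p ^ 2) ^ ((N : ℤ) + n) * p ^ 2 * p ^ 2 := by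
    rw [pow_succ, h4]
  have h6 : p ^ (2 * N + 1) * p ^ (2 * N + 1) =
      (p ^ 2) ^ ((N : ℤ) - n) * (p ^ 2) ^ ((N : ℤ) + n) * p ^ 2 := by
    rw [← h4]; ring
  rw [h6, h4, h5, g1, g2]
  generalize (p ^ 2) ^ ((N : ℤ) - n) = A at *
  generalize (p ^ 2) ^ ((N : ℤ) + n) = B at *
  generalize p ^ ((n - 1) ^ 2) = x at *
  generalize p ^ ((n + 1) ^ 2) = y at *
  generalize p ^ (n ^ 2) = w at *
  generalize p ^ (2 * N + 1) = v at *
  linear_combination (-(P * R1 * R2 * (1 - B) * (1 - B * p ^ 2))) * h1 -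
    (P * R1 * R2 * (1 - A) * (1 - A * p ^ 2)) * h2

/-- Finite form of the Jacobi triple product. Summing over all integers makes the shifts by `z` and
`z⁻¹` mere reindexings. -/
lemma hasSum_centralCoeff {p z : ℂ} (hp0 : p ≠ 0) (hp : ‖p‖ < 1) (hz : z ≠ 0) (N : ℕ) :
    HasSum (fun n : ℤ => centralCoeff (p ^ 2) N n * p ^ (n ^ 2) * z ^ n)
      (∏ k ∈ Finset.range N, ((1 + z * p ^ (2 * k + 1)) * (1 + z⁻¹ * p ^ (2 * k + 1)))) := by
  induction N with
  | zero =>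
    have h := hasSum_single (f := fun n : ℤ => centralCoeff (p ^ 2) 0 n * p ^ (n ^ 2) * z ^ n) 0
      (fun n hn => by
        rcases lt_or_gt_of_ne hn with h | h
        · simp [centralCoeff, recipPoch_of_neg _ h]
        · simp [centralCoeff, recipPoch_of_neg _ (show -n < 0 by omega)])
    simpa [centralCoeff, recipPoch] using h
  | succ N ih =>
    rw [Finset.prod_range_succ]
    set S := ∏ k ∈ Finset.range N, ((1 + z * p ^ (2 * k + 1)) * (1 + z⁻¹ * p ^ (2 * k + 1)))
    have hl := ((Equiv.subRight (1 : ℤ)).hasSum_iff).mpr ih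
    have hr := ((Equiv.addRight (1 : ℤ)).hasSum_iff).mpr ih
    have h := ((ih.mul_left (1 + p ^ (2 * N + 1) * p ^ (2 * N + 1))).add
      (hl.mul_left (z * p ^ (2 * N + 1)))).add (hr.mul_left (z⁻¹ * p ^ (2 * N + 1)))
    have hS : S * ((1 + z * p ^ (2 * N + 1)) * (1 + z⁻¹ * p ^ (2 * N + 1))) =
        (1 + p ^ (2 * N + 1) * p ^ (2 * N + 1)) * S + z * p ^ (2 * N + 1) * S +
          z⁻¹ * p ^ (2 * N + 1) * S := by
      field_simp
      ring
    rw [hS]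
    refine (congrArg (HasSum · _) (funext fun n => ?_)).mpr h
    simp only [Function.comp, Equiv.subRight_apply, Equiv.coe_addRight]
    rw [centralCoeff_succ hp0 hp, zpow_sub_one₀ hz, zpow_add_one₀ hz]
    field_simp

lemma norm_pow_lt_one {q : ℂ} (hq : ‖q‖ < 1) {k : ℕ} (hk : k ≠ 0) : ‖q ^ k‖ < 1 := by
  rw [norm_pow]; exact pow_lt_one₀ (norm_nonneg q) hq hk

lemma tendsto_finite_qPoch (a : ℂ) {q : ℂ} (hq : ‖q‖ < 1) :
    Tendsto (fun N => ∏ i ∈ Finset.range N, (1 - a * q ^ i)) atTop (𝓝 (qPoch a q)) :=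
  (qPoch_multipliable a hq).hasProd.tendsto_prod_nat

lemma tendsto_prod_one_sub_pow {q : ℂ} (hq : ‖q‖ < 1) :
    Tendsto (fun N => ∏ i ∈ Finset.range N, (1 - q ^ (i + 1))) atTop (𝓝 (qPoch q q)) := by
  simpa only [pow_succ'] using tendsto_finite_qPoch q hq

lemma tendsto_recipPoch {q : ℂ} (hq : ‖q‖ < 1) :
    Tendsto (recipPoch q) atTop (𝓝 (qPoch q q)⁻¹) := by
  have h := ((tendsto_prod_one_sub_pow hq).inv₀ (qPoch_ne_zero hq hq)).comp
    (tendsto_atTop_atTop.mpr fun b => ⟨(b : ℤ), fun a ha => by omega⟩ :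
      Tendsto Int.toNat atTop atTop)
  refine h.congr' ?_
  filter_upwards [eventually_ge_atTop 0] with k hk
  simp [recipPoch, hk]

lemma tendsto_centralCoeff {q : ℂ} (hq : ‖q‖ < 1) (n : ℤ) :
    Tendsto (fun N => centralCoeff q N n) atTop (𝓝 (qPoch q q)⁻¹) := by
  have h1 := (tendsto_prod_one_sub_pow hq).comp
    (tendsto_id.const_mul_atTop' (two_pos : (0 : ℕ) < 2))
  have h2 := (tendsto_recipPoch hq).comp
    (tendsto_atTop_add_const_right atTop (-n) (tendsto_natCast_atTop_atTop (R := ℤ)))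
  have h3 := (tendsto_recipPoch hq).comp
    (tendsto_atTop_add_const_right atTop n (tendsto_natCast_atTop_atTop (R := ℤ)))
  have h := (h1.mul h2).mul h3
  rw [mul_inv_cancel₀ (qPoch_ne_zero hq hq), one_mul] at h
  exact h

/-- A bound uniform in `N` and `n`, as dominated convergence requires for `N → ∞`. -/
lemma exists_norm_centralCoeff_le {q : ℂ} (hq : ‖q‖ < 1) :
    ∃ C : ℝ, ∀ N n, ‖centralCoeff q N n‖ ≤ C := by
  obtain ⟨C₁, h1⟩ := (tendsto_prod_one_sub_pow hq).norm.bddAbove_range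
  obtain ⟨C₂, h2⟩ :=
    ((tendsto_prod_one_sub_pow hq).inv₀ (qPoch_ne_zero hq hq)).norm.bddAbove_range
  have h1 : ∀ N, ‖∏ i ∈ Finset.range N, (1 - q ^ (i + 1))‖ ≤ C₁ := fun N => h1 ⟨N, rfl⟩
  have h2 : ∀ N, ‖(∏ i ∈ Finset.range N, (1 - q ^ (i + 1)))⁻¹‖ ≤ C₂ := fun N => h2 ⟨N, rfl⟩
  have hC₁ : 0 ≤ C₁ := (norm_nonneg _).trans (h1 0)
  have hC₂ : 0 ≤ C₂ := (norm_nonneg _).trans (h2 0)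
  have h3 : ∀ k, ‖recipPoch q k‖ ≤ C₂ := fun k => by
    unfold recipPoch
    split_ifs
    · exact h2 _
    · simpa using hC₂
  refine ⟨C₁ * C₂ * C₂, fun N n => ?_⟩
  unfold centralCoeff
  rw [norm_mul, norm_mul]
  gcongr
  exacts [h1 _, h3 _, h3 _]

/-- **Jacobi triple product identity.** -/
theorem tsum_zpow_mul_zpow_sq {p z : ℂ} (hp0 : p ≠ 0) (hp : ‖p‖ < 1) (hz : z ≠ 0)
    (hs : Summable fun n : ℤ => ‖p ^ (n ^ 2) * z ^ n‖) :
    ∑' n : ℤ, p ^ (n ^ 2) * z ^ n =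
      qPoch (p ^ 2) (p ^ 2) * qPoch (-(z * p)) (p ^ 2) * qPoch (-(z⁻¹ * p)) (p ^ 2) := by
  have hq : ‖p ^ 2‖ < 1 := norm_pow_lt_one hp two_ne_zero
  obtain ⟨C, hC⟩ := exists_norm_centralCoeff_le hq
  have hlim : Tendsto (fun N : ℕ => ∑' n : ℤ, centralCoeff (p ^ 2) N n * p ^ (n ^ 2) * z ^ n) atTop
      (𝓝 (∑' n : ℤ, (qPoch (p ^ 2) (p ^ 2))⁻¹ * p ^ (n ^ 2) * z ^ n)) := by
    refine tendsto_tsum_of_dominated_convergence (hs.mul_left C) (fun n => ?_)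
      (Eventually.of_forall fun N n => ?_)
    · exact ((tendsto_centralCoeff hq n).mul_const _).mul_const _
    · rw [mul_assoc, norm_mul]
      exact mul_le_mul_of_nonneg_right (hC N n) (norm_nonneg _)
  have hprod : Tendsto (fun N : ℕ => ∑' n : ℤ, centralCoeff (p ^ 2) N n * p ^ (n ^ 2) * z ^ n) atTop
      (𝓝 (qPoch (-(z * p)) (p ^ 2) * qPoch (-(z⁻¹ * p)) (p ^ 2))) := by
    refine ((tendsto_finite_qPoch _ hq).mul (tendsto_finite_qPoch _ hq)).congr fun N => ?_
    rw [(hasSum_centralCoeff hp0 hp hz N).tsum_eq, ← Finset.prod_mul_distrib]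
    refine Finset.prod_congr rfl fun k _ => ?_
    ring
  have h := tendsto_nhds_unique hlim hprod
  simp only [mul_assoc] at h ⊢
  rw [tsum_mul_left] at h
  rw [← h, mul_inv_cancel_left₀ (qPoch_ne_zero hq hq)]

/-- The factors of `(a; q)_∞` sorted by the residue of their index modulo `k`. -/
lemma qPoch_eq_prod_range (a : ℂ) {q : ℂ} (hq : ‖q‖ < 1) {k : ℕ} (hk : k ≠ 0) :
    qPoch a q = ∏ j ∈ Finset.range k, qPoch (a * q ^ j) (q ^ k) := by
  have h1 := (tendsto_finite_qPoch a hq).comp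
    (tendsto_id.const_mul_atTop' (Nat.pos_of_ne_zero hk))
  have h2 := tendsto_finsetProd (Finset.range k) fun j _ =>
    tendsto_finite_qPoch (a * q ^ j) (norm_pow_lt_one hq hk)
  refine tendsto_nhds_unique (h1.congr fun N => ?_) h2
  simp only [Function.comp, id]
  rw [Finset.prod_comm]
  induction N with
  | zero => simp
  | succ N ih =>
    rw [Finset.prod_range_succ, ← ih, Nat.mul_succ, Finset.prod_range_add]
    congr 1
    refine Finset.prod_congr rfl fun j _ => ?_
    rw [pow_add, pow_mul]; ring

/-! ### Theta series -/

/-- The monomial `(-1) ^ ε * q ^ e`. -/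
noncomputable def signedPow (q : ℂ) (ε e : ℤ) : ℂ := (-1) ^ ε * q ^ e

/-- The theta series `∑ (-1) ^ (σ n) q ^ (A n² + B n)` over all integers `n`. -/
noncomputable def theta (σ A B : ℤ) (q : ℂ) : ℂ := ∑' n : ℤ, signedPow q (σ * n) (A * n ^ 2 + B * n)

lemma signedPow_congr (q : ℂ) {ε ε' e e' : ℤ} (hε : Even (ε - ε')) (he : e = e') :
    signedPow q ε e = signedPow q ε' e' := by
  obtain ⟨k, hk⟩ := hε
  rw [signedPow, signedPow, he, show ε = ε' + 2 * k by omega, zpow_add₀ (by norm_num), zpow_mul]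
  simp

lemma signedPow_mul {q : ℂ} (hq : q ≠ 0) (ε ε' e e' : ℤ) :
    signedPow q ε e * signedPow q ε' e' = signedPow q (ε + ε') (e + e') := by
  rw [signedPow, signedPow, signedPow, zpow_add₀ (by norm_num), zpow_add₀ hq]
  ring

lemma signedPow_succ (q : ℂ) (ε e : ℤ) : signedPow q (ε + 1) e = -signedPow q ε e := by
  rw [signedPow, signedPow, zpow_add_one₀ (by norm_num)]
  ring

lemma norm_signedPow (q : ℂ) (ε e : ℤ) : ‖signedPow q ε e‖ = ‖q‖ ^ e := by
  simp [signedPow]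

lemma signedPow_zero (q : ℂ) (e : ℤ) : signedPow q 0 e = q ^ e := by simp [signedPow]

/-- The quadratic is at least `|n| (|n| - 1)`. This yields a geometric majorant that still covers
the boundary case `|B| = A`. -/
lemma abs_sub_one_le_quadratic {A B : ℤ} (hA : 1 ≤ A) (hB : |B| ≤ A) (n : ℤ) :
    |n| - 1 ≤ A * n ^ 2 + B * n := by
  have h1 : -(B * n) ≤ A * |n| := by
    calc -(B * n) ≤ |B * n| := neg_le_abs _
      _ = |B| * |n| := abs_mul _ _
      _ ≤ A * |n| := by gcongr
  have h2 : n ^ 2 = |n| ^ 2 := (sq_abs n).symm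
  have h3 : 0 ≤ |n| * (|n| - 1) := by
    rcases eq_or_lt_of_le (abs_nonneg n) with h | h
    · simp [← h]
    · exact mul_nonneg h.le (by omega)
  rw [h2]
  nlinarith [sq_nonneg (|n| - 1)]

lemma quadratic_nonneg {A B : ℤ} (hA : 1 ≤ A) (hB : |B| ≤ A) (n : ℤ) :
    0 ≤ A * n ^ 2 + B * n := by
  rcases eq_or_ne n 0 with rfl | h
  · simp
  · have := abs_sub_one_le_quadratic hA hB n
    have := Int.one_le_abs h
    omega

lemma summable_zpow_quadratic {A B : ℤ} (hA : 1 ≤ A) (hB : |B| ≤ A) {r : ℝ} (hr0 : 0 < r)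
    (hr : r < 1) : Summable fun n : ℤ => r ^ (A * n ^ 2 + B * n) := by
  have hg : Summable fun n : ℤ => r ^ (|n| - 1) := by
    have hs : Summable fun n : ℕ => r ^ n * r⁻¹ :=
      (summable_geometric_of_lt_one hr0.le hr).mul_right _
    refine Summable.of_nat_of_neg ?_ ?_
    · simpa [zpow_sub_one₀ hr0.ne'] using hs
    · simpa [zpow_sub_one₀ hr0.ne'] using hs
  refine Summable.of_nonneg_of_le (fun n => (zpow_pos hr0 _).le) (fun n => ?_) hg
  exact zpow_le_zpow_right_of_le_one₀ hr0 hr.le (abs_sub_one_le_quadratic hA hB n)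

lemma summable_norm_theta (σ : ℤ) {A B : ℤ} (hA : 1 ≤ A) (hB : |B| ≤ A) {q : ℂ} (hq0 : q ≠ 0)
    (hq : ‖q‖ < 1) : Summable fun n : ℤ => ‖signedPow q (σ * n) (A * n ^ 2 + B * n)‖ := by
  simp only [norm_signedPow]
  exact summable_zpow_quadratic hA hB (norm_pos_iff.mpr hq0) hq

lemma summable_theta_mul_theta (σ σ' : ℤ) {A B A' B' : ℤ} (hA : 1 ≤ A) (hB : |B| ≤ A)
    (hA' : 1 ≤ A') (hB' : |B'| ≤ A') {q : ℂ} (hq0 : q ≠ 0) (hq : ‖q‖ < 1) :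
    Summable fun x : ℤ × ℤ => signedPow q (σ * x.1 + σ' * x.2)
      (A * x.1 ^ 2 + B * x.1 + (A' * x.2 ^ 2 + B' * x.2)) := by
  simpa only [signedPow_mul hq0] using summable_mul_of_summable_norm
    (summable_norm_theta σ hA hB hq0 hq) (summable_norm_theta σ' hA' hB' hq0 hq)

lemma theta_mul_theta (σ σ' : ℤ) {A B A' B' : ℤ} (hA : 1 ≤ A) (hB : |B| ≤ A)
    (hA' : 1 ≤ A') (hB' : |B'| ≤ A') {q : ℂ} (hq0 : q ≠ 0) (hq : ‖q‖ < 1) :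
    theta σ A B q * theta σ' A' B' q = ∑' x : ℤ × ℤ, signedPow q (σ * x.1 + σ' * x.2)
      (A * x.1 ^ 2 + B * x.1 + (A' * x.2 ^ 2 + B' * x.2)) := by
  rw [theta, theta, tsum_mul_tsum_of_summable_norm
    (summable_norm_theta σ hA hB hq0 hq) (summable_norm_theta σ' hA' hB' hq0 hq)]
  simp only [signedPow_mul hq0]

lemma theta_neg (σ A B : ℤ) (q : ℂ) : theta σ A (-B) q = theta σ A B q := by
  rw [theta, ← (Equiv.neg ℤ).tsum_eq]
  refine tsum_congr fun n => signedPow_congr q ⟨-(σ * n), ?_⟩ ?_ <;> simp <;> ring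

/-- A theta series whose terms cancel in pairs. -/
lemma theta_one_self (A : ℤ) (q : ℂ) : theta 1 A A q = 0 := by
  have h : theta 1 A A q = -theta 1 A A q := by
    -- The reflection `n ↦ -1 - n` fixes `A n² + A n` and changes the parity of `n`.
    conv_lhs => rw [theta, ← (Equiv.subLeft (-1 : ℤ)).tsum_eq]
    rw [theta, ← tsum_neg]
    refine tsum_congr fun n => ?_
    rw [← signedPow_succ]
    refine signedPow_congr q ⟨-n - 1, ?_⟩ ?_ <;> simp <;> ring
  linear_combination h / 2

lemma theta_pow (σ A B : ℤ) (q : ℂ) (k : ℕ) : theta σ A B (q ^ k) = theta σ (k * A) (k * B) q := by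
  refine tsum_congr fun n => ?_
  rw [signedPow, signedPow, ← zpow_natCast, ← zpow_mul]
  congr 2
  ring

/-- The triple product for theta series: here `p` is a square root of the variable of the
product. -/
lemma theta_eq_prod (σ : ℤ) {A B : ℕ} (hA : 1 ≤ A) (hB : B ≤ A) {p : ℂ} (hp0 : p ≠ 0)
    (hp : ‖p‖ < 1) :
    theta σ A B p = qPoch (p ^ (2 * A)) (p ^ (2 * A)) *
      qPoch (-((-1) ^ σ * p ^ (A + B))) (p ^ (2 * A)) *
      qPoch (-((-1) ^ σ * p ^ (A - B))) (p ^ (2 * A)) := by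
  have hterm : ∀ n : ℤ, signedPow p (σ * n) (A * n ^ 2 + B * n) =
      (p ^ A) ^ (n ^ 2) * ((-1) ^ σ * p ^ B) ^ n := fun n => by
    rw [signedPow, mul_zpow, zpow_add₀ hp0, zpow_mul, zpow_mul, zpow_mul, zpow_natCast,
      zpow_natCast]
    ring
  have hs : ((-1 : ℂ) ^ σ)⁻¹ = (-1) ^ σ := by
    rw [← inv_zpow]; norm_num
  have hpA : p ^ (A - B) = (p ^ B)⁻¹ * p ^ A := by
    rw [eq_inv_mul_iff_mul_eq₀ (pow_ne_zero _ hp0), ← pow_add]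
    congr 1; omega
  have hsum : Summable fun n : ℤ => ‖(p ^ A) ^ (n ^ 2) * ((-1) ^ σ * p ^ B) ^ n‖ := by
    have h := summable_norm_theta σ (A := A) (B := B) (by exact_mod_cast hA)
      (by simpa using hB) hp0 hp
    simpa only [hterm] using h
  have h1 : p ^ (2 * A) = (p ^ A) ^ 2 := by rw [← pow_mul, mul_comm]
  have h2 : (-1 : ℂ) ^ σ * p ^ (A + B) = (-1) ^ σ * p ^ B * p ^ A := by rw [pow_add]; ring
  have h3 : (-1 : ℂ) ^ σ * p ^ (A - B) = ((-1) ^ σ * p ^ B)⁻¹ * p ^ A := by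
    rw [hpA, mul_inv, hs]; ring
  rw [theta, tsum_congr hterm, h1, h2, h3]
  exact tsum_zpow_mul_zpow_sq (pow_ne_zero _ hp0) (norm_pow_lt_one hp (by omega))
    (mul_ne_zero (zpow_ne_zero _ (by norm_num)) (pow_ne_zero _ hp0)) hsum

/-! ### Rearrangements of double theta series -/

lemma tsum_eq_sum_tsum_of_bijective {K : ℕ} {f : ℤ × ℤ → ℂ} (hf : Summable f)
    {e : Fin K → ℤ × ℤ → ℤ × ℤ}
    (he : Function.Bijective fun x : Fin K × ℤ × ℤ => e x.1 x.2) :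
    ∑' x, f x = ∑ k, ∑' y, f (e k y) := by
  have hs : Summable fun x : Fin K × ℤ × ℤ => f (e x.1 x.2) :=
    hf.comp_injective he.injective
  rw [← (Equiv.ofBijective _ he).tsum_eq f]
  simp only [Equiv.ofBijective_apply]
  rw [hs.tsum_prod, tsum_fintype]

/-- The sum over one coset of a sublattice, recognised as a product of two theta series. -/
lemma tsum_signedPow_eq {q : ℂ} (hq0 : q ≠ 0) (hq : ‖q‖ < 1) {ε e : ℤ × ℤ → ℤ}
    (ε₀ e₀ σ σ' : ℤ) {A B A' B' : ℤ} (hA : 1 ≤ A) (hB : |B| ≤ A) (hA' : 1 ≤ A') (hB' : |B'| ≤ A')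
    (hε : ∀ u v, ∃ j, ε (u, v) = ε₀ + (σ * u + σ' * v) + 2 * j)
    (he : ∀ u v, e (u, v) = e₀ + (A * u ^ 2 + B * u + (A' * v ^ 2 + B' * v))) :
    ∑' y, signedPow q (ε y) (e y) =
      signedPow q ε₀ e₀ * (theta σ A B q * theta σ' A' B' q) := by
  rw [theta_mul_theta σ σ' hA hB hA' hB' hq0 hq, ← tsum_mul_left]
  refine tsum_congr fun y => ?_
  rw [signedPow_mul hq0]
  obtain ⟨j, hj⟩ := hε y.1 y.2
  exact signedPow_congr q ⟨j, by rw [hj]; ring⟩ (he y.1 y.2)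

/-- The cosets of the sublattice `{(2u + v, 2v - u)}` of index five. -/
lemma bijective_index_five {m n : Fin 5 → ℤ} (h : ∀ k, (m k + 2 * n k) % 5 = k) :
    Function.Bijective fun x : Fin 5 × ℤ × ℤ =>
      (2 * x.2.1 + x.2.2 + m x.1, 2 * x.2.2 - x.2.1 + n x.1) := by
  -- Since `(2u + v) + 2 (2v - u) = 5v`, the residue of `a + 2b` modulo five labels the coset of
  -- `(a, b)`.
  constructor
  · rintro ⟨k, u, v⟩ ⟨k', u', v'⟩ hxy
    simp only [Prod.mk.injEq] at hxy
    have hk : k = k' := by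
      have h1 := h k
      have h2 := h k'
      apply Fin.ext
      omega
    subst hk
    simp only [Prod.mk.injEq, true_and]
    omega
  · rintro ⟨a, b⟩
    obtain ⟨k, hk⟩ : ∃ k : Fin 5, (k : ℤ) = (a + 2 * b) % 5 :=
      ⟨⟨((a + 2 * b) % 5).toNat, by omega⟩, by simp; omega⟩
    have h1 := h k
    refine ⟨(k, (2 * (a - m k) - (b - n k)) / 5, ((a - m k) + 2 * (b - n k)) / 5), ?_⟩
    simp only [Prod.mk.injEq]
    omega

/-- Two theta series of the same period, split by the parity of the sum of the indices. -/
lemma theta_mul_theta_parity (τ : ℤ) {A C D : ℤ} (hA : 1 ≤ A) (h1 : |C + D| ≤ A)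
    (h2 : |C - D| ≤ A) (hC : |C| ≤ A) (hD : |D| ≤ A) (hCA : |C - A| ≤ A) (hDA : |D - A| ≤ A)
    {p : ℂ} (hp0 : p ≠ 0) (hp : ‖p‖ < 1) :
    theta τ A (C + D) p * theta τ A (C - D) p =
      theta 0 A C (p ^ 2) * theta 0 A D (p ^ 2) +
      signedPow p τ (A - C - D) * (theta 0 A (C - A) (p ^ 2) * theta 0 A (D - A) (p ^ 2)) := by
  -- With `x = u + v - k` and `y = u - v` the mixed terms cancel; `k = 1` covers the pairs of odd
  -- sum and shifts `C` and `D` by `-A`.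
  have hb : Function.Bijective fun x : Fin 2 × ℤ × ℤ =>
      (x.2.1 + x.2.2 - (x.1 : ℤ), x.2.1 - x.2.2) := by
    constructor
    · rintro ⟨k, u, v⟩ ⟨k', u', v'⟩ hxy
      simp only [Prod.mk.injEq] at hxy ⊢
      refine ⟨Fin.ext ?_, ?_, ?_⟩ <;> omega
    · rintro ⟨a, b⟩
      refine ⟨(⟨((a + b) % 2).toNat, by omega⟩, (a + b + 1) / 2, (a - b + 1) / 2), ?_⟩
      simp only [Prod.mk.injEq]
      omega
  have hb' (X : ℤ) (hX : |X| ≤ A) : |((2 : ℕ) : ℤ) * X| ≤ (2 : ℕ) * A := by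
    rw [abs_mul]; simpa using hX
  have hA' : 1 ≤ ((2 : ℕ) : ℤ) * A := by push_cast; omega
  simp only [theta_pow]
  rw [theta_mul_theta τ τ hA h1 hA h2 hp0 hp,
    tsum_eq_sum_tsum_of_bijective (summable_theta_mul_theta τ τ hA h1 hA h2 hp0 hp)
      (e := fun k y => (y.1 + y.2 - (k : ℤ), y.1 - y.2)) hb, Fin.sum_univ_two,
    tsum_signedPow_eq hp0 hp 0 0 0 0 hA' (hb' C hC) hA' (hb' D hD),
    tsum_signedPow_eq hp0 hp τ (A - C - D) 0 0 hA' (hb' _ hCA) hA' (hb' _ hDA)]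
  · simp [signedPow]
  · intro u v; exact ⟨τ * u - τ, by simp; ring⟩
  · intro u v; simp; ring
  · intro u v; exact ⟨τ * u, by simp; ring⟩
  · intro u v; simp; ring

/-! ### Splittings of index five -/

lemma signedPow_one (q : ℂ) (e : ℤ) : signedPow q 1 e = -q ^ e := by simp [signedPow]

/-- The nontrivial cosets are represented by the four shortest vectors `(±1, 0)`, `(0, ±1)`, and
symmetry gives them equal sums. -/
lemma theta_zero_one_zero_sq {q : ℂ} (hq0 : q ≠ 0) (hq : ‖q‖ < 1) :
    theta 0 1 0 q ^ 2 = theta 0 5 0 q ^ 2 + 4 * q * (theta 0 5 4 q * theta 0 5 2 q) := by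
  have hb := bijective_index_five (m := ![0, 1, 0, 0, -1]) (n := ![0, 0, 1, -1, 0])
    (by intro k; fin_cases k <;> rfl)
  rw [sq, sq, theta_mul_theta 0 0 (by norm_num) (by norm_num) (by norm_num) (by norm_num) hq0 hq,
    tsum_eq_sum_tsum_of_bijective (summable_theta_mul_theta 0 0 (by norm_num) (by norm_num)
      (by norm_num) (by norm_num) hq0 hq)
      (e := fun k y => (2 * y.1 + y.2 + ![0, 1, 0, 0, -1] k, 2 * y.2 - y.1 + ![0, 0, 1, -1, 0] k)) hb, Fin.sum_univ_five,
    tsum_signedPow_eq hq0 hq 0 0 0 0 (A := 5) (B := 0) (A' := 5) (B' := 0),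
    tsum_signedPow_eq hq0 hq 0 1 0 0 (A := 5) (B := 4) (A' := 5) (B' := 2),
    tsum_signedPow_eq hq0 hq 0 1 0 0 (A := 5) (B := -2) (A' := 5) (B' := 4),
    tsum_signedPow_eq hq0 hq 0 1 0 0 (A := 5) (B := 2) (A' := 5) (B' := -4),
    tsum_signedPow_eq hq0 hq 0 1 0 0 (A := 5) (B := -4) (A' := 5) (B' := -2)]
  · simp only [theta_neg, signedPow_zero, zpow_zero, zpow_one]
    ring
  all_goals first
    | intro u v; exact ⟨0, by simp⟩
    | intro u v; simp; ring
    | norm_num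

/-- The form is now centred at `(-1/2, -1/2)`: four cosets are represented by the nearest lattice
points, with equal sums, and the fifth, through `(1, 0)`, supplies the `q ^ 2` term. -/
lemma theta_zero_one_one_sq {q : ℂ} (hq0 : q ≠ 0) (hq : ‖q‖ < 1) :
    theta 0 1 1 q ^ 2 = q ^ 2 * theta 0 5 5 q ^ 2 + 4 * (theta 0 5 3 q * theta 0 5 1 q) := by
  have hb := bijective_index_five (m := ![0, 1, -1, 0, -1]) (n := ![0, 0, -1, -1, 0])
    (by intro k; fin_cases k <;> rfl)
  rw [sq (theta 0 1 1 q), sq (theta 0 5 5 q),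
    theta_mul_theta 0 0 (by norm_num) (by norm_num) (by norm_num) (by norm_num) hq0 hq,
    tsum_eq_sum_tsum_of_bijective (summable_theta_mul_theta 0 0 (by norm_num) (by norm_num)
      (by norm_num) (by norm_num) hq0 hq)
      (e := fun k y => (2 * y.1 + y.2 + ![0, 1, -1, 0, -1] k, 2 * y.2 - y.1 + ![0, 0, -1, -1, 0] k)) hb, Fin.sum_univ_five,
    tsum_signedPow_eq hq0 hq 0 0 0 0 (A := 5) (B := 1) (A' := 5) (B' := 3),
    tsum_signedPow_eq hq0 hq 0 2 0 0 (A := 5) (B := 5) (A' := 5) (B' := 5),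
    tsum_signedPow_eq hq0 hq 0 0 0 0 (A := 5) (B := -1) (A' := 5) (B' := -3),
    tsum_signedPow_eq hq0 hq 0 0 0 0 (A := 5) (B := 3) (A' := 5) (B' := -1),
    tsum_signedPow_eq hq0 hq 0 0 0 0 (A := 5) (B := -3) (A' := 5) (B' := 1)]
  · simp only [theta_neg, signedPow_zero, zpow_ofNat]
    ring
  all_goals first
    | intro u v; exact ⟨0, by simp⟩
    | intro u v; simp; ring
    | norm_num

/-- The 5-dissection of `f(q⁴, q⁶) f(-q², -q⁸)`. -/
lemma dissection_theta_one {q : ℂ} (hq0 : q ≠ 0) (hq : ‖q‖ < 1) :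
    theta 0 5 1 q * theta 1 5 3 q =
      theta 1 5 1 (q ^ 5) * theta 0 5 1 (q ^ 5) - q ^ 2 * (theta 1 5 1 (q ^ 5) * theta 0 5 3 (q ^ 5))
      - q ^ 8 * (theta 1 5 3 (q ^ 5) * theta 0 5 5 (q ^ 5))
      + q ^ 4 * (theta 1 5 3 (q ^ 5) * theta 0 5 3 (q ^ 5)) := by
  -- Negating the second coordinate makes the linear part `x + 3y = 5u - 5v` divisible by five, so
  -- each coset sum is a product of theta series in `q ^ 5`.
  have hb := ((Equiv.refl ℤ).prodCongr (Equiv.neg ℤ)).bijective.comp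
    (bijective_index_five (m := ![0, 1, 0, 0, -1]) (n := ![0, 0, 1, -1, 0])
      (by intro k; fin_cases k <;> rfl))
  have h0 : theta 1 25 25 q = 0 := theta_one_self 25 q
  rw [theta_mul_theta 0 1 (by norm_num) (by norm_num) (by norm_num) (by norm_num) hq0 hq,
    tsum_eq_sum_tsum_of_bijective (summable_theta_mul_theta 0 1 (by norm_num) (by norm_num)
      (by norm_num) (by norm_num) hq0 hq)
      (e := fun k y => (2 * y.1 + y.2 + ![0, 1, 0, 0, -1] k, -(2 * y.2 - y.1 + ![0, 0, 1, -1, 0] k))) hb, Fin.sum_univ_five,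
    tsum_signedPow_eq hq0 hq 0 0 1 0 (A := 25) (B := 5) (A' := 25) (B' := -5),
    tsum_signedPow_eq hq0 hq 0 6 1 0 (A := 25) (B := 25) (A' := 25) (B' := 5),
    tsum_signedPow_eq hq0 hq 1 2 1 0 (A := 25) (B := -5) (A' := 25) (B' := 15),
    tsum_signedPow_eq hq0 hq 1 8 1 0 (A := 25) (B := 15) (A' := 25) (B' := -25),
    tsum_signedPow_eq hq0 hq 0 4 1 0 (A := 25) (B := -15) (A' := 25) (B' := -15)]
  · simp only [theta_neg, h0, signedPow_zero, signedPow_one, zpow_ofNat, theta_pow]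
    norm_num
    ring
  all_goals first
    | intro u v; exact ⟨-v, by simp; ring1⟩
    | intro u v; exact ⟨-v - 1, by simp; ring1⟩
    | intro u v; simp; ring
    | norm_num

/-- The 5-dissection of `f(q, q⁹) f(-q², -q⁸)`. -/
lemma dissection_theta_four {q : ℂ} (hq0 : q ≠ 0) (hq : ‖q‖ < 1) :
    theta 0 5 4 q * theta 1 5 3 q =
      theta 1 5 1 (q ^ 5) * theta 0 5 2 (q ^ 5) + q * (theta 1 5 3 (q ^ 5) * theta 0 5 0 (q ^ 5))
      - q ^ 2 * (theta 1 5 3 (q ^ 5) * theta 0 5 2 (q ^ 5))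
      - q ^ 3 * (theta 1 5 1 (q ^ 5) * theta 0 5 4 (q ^ 5)) := by
  have hb := bijective_index_five (m := ![0, 1, -1, 0, -1]) (n := ![0, 0, -1, -1, 0])
    (by intro k; fin_cases k <;> rfl)
  -- This removes the coset of leading exponent 9, which the later factor `q ^ 2` would move to
  -- residue 1.
  have h0 : theta 1 25 25 q = 0 := theta_one_self 25 q
  rw [theta_mul_theta 0 1 (by norm_num) (by norm_num) (by norm_num) (by norm_num) hq0 hq,
    tsum_eq_sum_tsum_of_bijective (summable_theta_mul_theta 0 1 (by norm_num) (by norm_num)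
      (by norm_num) (by norm_num) hq0 hq)
      (e := fun k y => (2 * y.1 + y.2 + ![0, 1, -1, 0, -1] k, 2 * y.2 - y.1 + ![0, 0, -1, -1, 0] k)) hb, Fin.sum_univ_five,
    tsum_signedPow_eq hq0 hq 0 0 1 0 (A := 25) (B := 5) (A' := 25) (B' := 10),
    tsum_signedPow_eq hq0 hq 0 9 1 0 (A := 25) (B := 25) (A' := 25) (B' := 20),
    tsum_signedPow_eq hq0 hq 1 3 1 0 (A := 25) (B := -5) (A' := 25) (B' := -20),
    tsum_signedPow_eq hq0 hq 1 2 1 0 (A := 25) (B := 15) (A' := 25) (B' := -10),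
    tsum_signedPow_eq hq0 hq 0 1 1 0 (A := 25) (B := -15) (A' := 25) (B' := 0)]
  · simp only [theta_neg, h0, signedPow_zero, signedPow_one, zpow_ofNat, theta_pow]
    norm_num
    ring
  all_goals first
    | intro u v; exact ⟨v - u, by simp; ring1⟩
    | intro u v; exact ⟨v - u - 1, by simp; ring1⟩
    | intro u v; simp; ring
    | norm_num

/-! ### The product `(q; q)_∞ (q⁵; q⁵)_∞` as a difference of theta products -/

/-- Both double series on the left are split by the index sum modulo three. The middle classes
agree; each of the other two differences is the right-hand double series, without its factor 2,
split by parity. -/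
lemma theta_determinant {p : ℂ} (hp0 : p ≠ 0) (hp : ‖p‖ < 1) :
    theta 0 1 1 (p ^ 2) * theta 0 5 0 (p ^ 2) - p ^ 2 * (theta 0 1 0 (p ^ 2) * theta 0 5 5 (p ^ 2)) =
      2 * (theta 1 3 1 p * theta 1 3 1 (p ^ 5)) := by
  have hb3 : Function.Bijective fun x : Fin 3 × ℤ × ℤ =>
      (3 * x.2.1 + (x.1 : ℤ) - x.2.2, x.2.2) := by
    constructor
    · rintro ⟨k, u, v⟩ ⟨k', u', v'⟩ hxy
      simp only [Prod.mk.injEq] at hxy ⊢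
      refine ⟨Fin.ext ?_, ?_, ?_⟩ <;> omega
    · rintro ⟨a, b⟩
      refine ⟨(⟨((a + b) % 3).toNat, by omega⟩, (a + b) / 3, b), ?_⟩
      simp only [Prod.mk.injEq, and_true]
      omega
  have hb2 : Function.Bijective fun x : Fin 2 × ℤ × ℤ =>
      (x.2.1 - 2 * x.2.2 - (x.1 : ℤ), x.2.1) := by
    constructor
    · rintro ⟨k, u, v⟩ ⟨k', u', v'⟩ hxy
      simp only [Prod.mk.injEq] at hxy ⊢
      refine ⟨Fin.ext ?_, ?_, ?_⟩ <;> omega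
    · rintro ⟨a, b⟩
      refine ⟨(⟨((a + b) % 2).toNat, by omega⟩, b, (b - a) / 2), ?_⟩
      simp only [Prod.mk.injEq, and_true]
      omega
  have hb2' : Function.Bijective fun x : Fin 2 × ℤ × ℤ =>
      (-x.2.1 - 1 + 2 * x.2.2 + (x.1 : ℤ), -x.2.1 - 1) := by
    constructor
    · rintro ⟨k, u, v⟩ ⟨k', u', v'⟩ hxy
      simp only [Prod.mk.injEq] at hxy ⊢
      refine ⟨Fin.ext ?_, ?_, ?_⟩ <;> omega
    · rintro ⟨a, b⟩
      refine ⟨(⟨((a + b) % 2).toNat, by omega⟩, -b - 1, (a - b) / 2), ?_⟩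
      simp only [Prod.mk.injEq]
      omega
  have hs1 := summable_theta_mul_theta 0 0 (A := 2) (B := 2) (A' := 10) (B' := 0)
    (by norm_num) (by norm_num) (by norm_num) (by norm_num) hp0 hp
  have hs2 := summable_theta_mul_theta 0 0 (A := 2) (B := 0) (A' := 10) (B' := 10)
    (by norm_num) (by norm_num) (by norm_num) (by norm_num) hp0 hp
  have hsE := summable_theta_mul_theta 1 1 (A := 3) (B := 1) (A' := 15) (B' := 5)
    (by norm_num) (by norm_num) (by norm_num) (by norm_num) hp0 hp
  set c₁ : Fin 3 → ℂ := fun j => ∑' y : ℤ × ℤ, signedPow p 0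
    (2 * (3 * y.1 + (j : ℤ) - y.2) ^ 2 + 2 * (3 * y.1 + (j : ℤ) - y.2) + 10 * y.2 ^ 2) with hc₁
  set c₂ : Fin 3 → ℂ := fun j => ∑' y : ℤ × ℤ, signedPow p 0
    (2 + 2 * (3 * y.1 + (j : ℤ) - y.2) ^ 2 + (10 * y.2 ^ 2 + 10 * y.2)) with hc₂
  have h1 : theta 0 1 1 (p ^ 2) * theta 0 5 0 (p ^ 2) = c₁ 0 + c₁ 1 + c₁ 2 := by
    simp only [theta_pow]
    norm_num
    rw [theta_mul_theta 0 0 (by norm_num) (by norm_num) (by norm_num) (by norm_num) hp0 hp,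
      tsum_eq_sum_tsum_of_bijective hs1 (e := fun j y => (3 * y.1 + (j : ℤ) - y.2, y.2)) hb3,
      ← Fin.sum_univ_three]
    refine Finset.sum_congr rfl fun j _ => tsum_congr fun y => signedPow_congr p ⟨0, by simp⟩ ?_
    ring
  have h2 : p ^ 2 * (theta 0 1 0 (p ^ 2) * theta 0 5 5 (p ^ 2)) = c₂ 0 + c₂ 1 + c₂ 2 := by
    simp only [theta_pow]
    norm_num
    rw [theta_mul_theta 0 0 (by norm_num) (by norm_num) (by norm_num) (by norm_num) hp0 hp,
      tsum_eq_sum_tsum_of_bijective hs2 (e := fun j y => (3 * y.1 + (j : ℤ) - y.2, y.2)) hb3,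
      ← Fin.sum_univ_three, Finset.mul_sum]
    refine Finset.sum_congr rfl fun j _ => ?_
    rw [← tsum_mul_left]
    refine tsum_congr fun y => ?_
    rw [show p ^ 2 = signedPow p 0 2 by simp [signedPow], signedPow_mul hp0]
    refine signedPow_congr p ⟨0, by simp⟩ ?_
    ring
  -- The involution `(u, v) ↦ (u, u - v)` interchanges the two exponents.
  have h3 : c₁ 1 = c₂ 1 := by
    let φ : ℤ × ℤ ≃ ℤ × ℤ :=
      ⟨fun y => (y.1, y.1 - y.2), fun y => (y.1, y.1 - y.2), fun y => by simp, fun y => by simp⟩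
    simp only [hc₂]
    rw [← φ.tsum_eq]
    refine tsum_congr fun y => signedPow_congr p ⟨0, by simp⟩ ?_
    simp [φ]
    ring
  have hE : theta 1 3 1 p * theta 1 3 1 (p ^ 5) = ∑' x : ℤ × ℤ, signedPow p (1 * x.1 + 1 * x.2)
      (3 * x.1 ^ 2 + 1 * x.1 + (15 * x.2 ^ 2 + 5 * x.2)) := by
    rw [theta_pow]
    norm_num
    rw [theta_mul_theta 1 1 (by norm_num) (by norm_num) (by norm_num) (by norm_num) hp0 hp]
    simp
  have h4 : theta 1 3 1 p * theta 1 3 1 (p ^ 5) = c₁ 0 - c₂ 0 := by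
    rw [hE, tsum_eq_sum_tsum_of_bijective hsE
      (e := fun j y => (y.1 - 2 * y.2 - (j : ℤ), y.1)) hb2, Fin.sum_univ_two, sub_eq_add_neg,
      ← tsum_neg]
    congr 1
    · refine tsum_congr fun y => signedPow_congr p ⟨y.1 - y.2, by simp; ring⟩ ?_
      simp
      ring
    · refine tsum_congr fun y => ?_
      rw [← signedPow_succ]
      refine signedPow_congr p ⟨y.1 - y.2 - 1, by simp; ring⟩ ?_
      simp
      ring
  have h5 : theta 1 3 1 p * theta 1 3 1 (p ^ 5) = c₁ 2 - c₂ 2 := by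
    rw [hE, tsum_eq_sum_tsum_of_bijective hsE
      (e := fun j y => (-y.1 - 1 + 2 * y.2 + (j : ℤ), -y.1 - 1)) hb2', Fin.sum_univ_two,
      sub_eq_add_neg, ← tsum_neg]
    congr 1
    · refine tsum_congr fun y => signedPow_congr p ⟨-y.1 - 1 + y.2, by simp; ring⟩ ?_
      simp
      ring
    · refine tsum_congr fun y => ?_
      rw [← signedPow_succ]
      refine signedPow_congr p ⟨-y.1 + y.2 - 1, by simp; ring⟩ ?_
      simp
      ring
  linear_combination h1 - h2 + h3 - h4 - h5

/-! ### Relations between theta series of levels one and five -/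

lemma differentiableOn_theta (σ : ℤ) {A B : ℤ} (hA : 1 ≤ A) (hB : |B| ≤ A) :
    DifferentiableOn ℂ (theta σ A B) (Metric.ball 0 1) := by
  intro w hw
  rw [mem_ball_zero_iff] at hw
  obtain ⟨r, hwr, hr⟩ := exists_between hw
  have hr0 : 0 < r := (norm_nonneg w).trans_lt hwr
  have h : DifferentiableOn ℂ (theta σ A B) (Metric.ball 0 r) := by
    refine Complex.differentiableOn_tsum_of_summable_norm (summable_zpow_quadratic hA hB hr0 hr)
      (fun n z _ => ?_) Metric.isOpen_ball (fun n z hz => ?_)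
    · exact ((differentiableAt_zpow.mpr (Or.inr (quadratic_nonneg hA hB n))).const_mul
        _).differentiableWithinAt
    · rw [norm_signedPow]
      rw [mem_ball_zero_iff] at hz
      exact zpow_le_zpow_left₀ (quadratic_nonneg hA hB n) (norm_nonneg z) hz.le
  exact (h.differentiableAt (Metric.isOpen_ball.mem_nhds
    (mem_ball_zero_iff.mpr hwr))).differentiableWithinAt

lemma theta_zero_right (σ : ℤ) {A B : ℤ} (hB : |B| < A) : theta σ A B 0 = 1 := by
  rw [theta, tsum_eq_single 0]
  · simp [signedPow]
  · intro n hn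
    have h : A * n ^ 2 + B * n ≠ 0 := by
      intro h
      have h1 : n * (A * n + B) = 0 := by linear_combination h
      have h2 : B = -(A * n) := by
        rcases mul_eq_zero.mp h1 with h | h
        · exact absurd h hn
        · omega
      have hA : 0 < A := (abs_nonneg B).trans_lt hB
      rw [h2, abs_neg, abs_mul, abs_of_pos hA] at hB
      nlinarith [Int.one_le_abs hn]
    simp [signedPow, zero_zpow _ h]

/-- At the boundary `B = A` the exponent vanishes at both `n = 0` and `n = -1`, and `0 ^ 0 = 1`. -/
lemma theta_zero_one_one_zero : theta 0 1 1 0 = 2 := by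
  rw [theta, tsum_eq_sum (s := {0, -1})]
  · simp [signedPow]
    norm_num
  · intro n hn
    simp only [Finset.mem_insert, Finset.mem_singleton, not_or] at hn
    have h : (1 : ℤ) * n ^ 2 + 1 * n ≠ 0 := by
      rw [show (1 : ℤ) * n ^ 2 + 1 * n = n * (n + 1) by ring]
      exact mul_ne_zero hn.1 (by omega)
    rw [signedPow, zero_zpow _ h, mul_zero]

/-- If a product of two holomorphic functions on the unit disc vanishes away from the origin and
the second factor does not vanish at the origin, then the first factor vanishes. -/
lemma eq_zero_of_mul_eq_zero {f g : ℂ → ℂ} (hf : DifferentiableOn ℂ f (Metric.ball 0 1))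
    (hg : DifferentiableOn ℂ g (Metric.ball 0 1)) (hg0 : g 0 ≠ 0)
    (h : ∀ q : ℂ, q ≠ 0 → ‖q‖ < 1 → f q * g q = 0) {q : ℂ} (hq : ‖q‖ < 1) : f q = 0 := by
  have h0 : (0 : ℂ) ∈ Metric.ball (0 : ℂ) 1 := by simp
  have hball : Metric.ball (0 : ℂ) 1 ∈ 𝓝 0 := Metric.isOpen_ball.mem_nhds h0
  have hev : ∀ᶠ z in 𝓝[≠] (0 : ℂ), f z = 0 := by
    have h1 := (hg.differentiableAt hball).continuousAt.eventually_ne hg0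
    filter_upwards [nhdsWithin_le_nhds h1, nhdsWithin_le_nhds hball, self_mem_nhdsWithin]
      with z hz1 hz2 hz3
    exact (mul_eq_zero.mp (h z hz3 (mem_ball_zero_iff.mp hz2))).resolve_right hz1
  exact (hf.analyticOnNhd Metric.isOpen_ball).eqOn_zero_of_preconnected_of_frequently_eq_zero
    (convex_ball 0 1).isPreconnected h0 hev.frequently (mem_ball_zero_iff.mpr hq)

/-! ### Product forms and parity splittings of the particular theta series -/

lemma neg_neg_one_zpow_one_mul (x : ℂ) : -((-1 : ℂ) ^ (1 : ℤ) * x) = x := by simp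

/-- Euler's pentagonal number theorem: the triple product gives the three residue classes modulo
three of the factors of `(p²; p²)`. -/
lemma theta_one_three_one {p : ℂ} (hp0 : p ≠ 0) (hp : ‖p‖ < 1) :
    theta 1 3 1 p = qPoch (p ^ 2) (p ^ 2) := by
  have h := theta_eq_prod 1 (A := 3) (B := 1) (by norm_num) (by norm_num) hp0 hp
  rw [qPoch_eq_prod_range (p ^ 2) (norm_pow_lt_one hp two_ne_zero) three_ne_zero]
  simp only [Finset.prod_range_succ, Finset.prod_range_zero, neg_neg_one_zpow_one_mul] at h ⊢
  push_cast at h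
  rw [h]
  norm_num [← pow_mul, ← pow_add]
  ring

lemma theta_one_five_one {p q : ℂ} (hpq : p ^ 2 = q) (hp0 : p ≠ 0) (hp : ‖p‖ < 1) :
    theta 1 5 1 p = qPoch (q ^ 5) (q ^ 5) * qPoch (q ^ 3) (q ^ 5) * qPoch (q ^ 2) (q ^ 5) := by
  have h := theta_eq_prod 1 (A := 5) (B := 1) (by norm_num) (by norm_num) hp0 hp
  simp only [neg_neg_one_zpow_one_mul] at h
  push_cast at h
  rw [h, ← hpq]
  norm_num [← pow_mul]

lemma theta_one_five_three {p q : ℂ} (hpq : p ^ 2 = q) (hp0 : p ≠ 0) (hp : ‖p‖ < 1) :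
    theta 1 5 3 p = qPoch (q ^ 5) (q ^ 5) * qPoch (q ^ 4) (q ^ 5) * qPoch q (q ^ 5) := by
  have h := theta_eq_prod 1 (A := 5) (B := 3) (by norm_num) (by norm_num) hp0 hp
  simp only [neg_neg_one_zpow_one_mul] at h
  push_cast at h
  rw [h, ← hpq]
  norm_num [← pow_mul]

lemma theta_zero_five_one {p q : ℂ} (hpq : p ^ 2 = q) (hp0 : p ≠ 0) (hp : ‖p‖ < 1) :
    theta 0 5 1 p = qPoch (q ^ 5) (q ^ 5) * qPoch (-q ^ 3) (q ^ 5) * qPoch (-q ^ 2) (q ^ 5) := by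
  have h := theta_eq_prod 0 (A := 5) (B := 1) (by norm_num) (by norm_num) hp0 hp
  simp only [zpow_zero, one_mul] at h
  push_cast at h
  rw [h, ← hpq]
  norm_num [← pow_mul]

/-- `(q; q)_∞` split modulo five. -/
lemma qPoch_self_eq_five {q : ℂ} (hq : ‖q‖ < 1) :
    qPoch q q = qPoch q (q ^ 5) * qPoch (q ^ 2) (q ^ 5) * qPoch (q ^ 3) (q ^ 5) *
      qPoch (q ^ 4) (q ^ 5) * qPoch (q ^ 5) (q ^ 5) := by
  rw [qPoch_eq_prod_range q hq (k := 5) (by norm_num)]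
  simp only [Finset.prod_range_succ, Finset.prod_range_zero, one_mul, ← pow_succ',
    Nat.reduceAdd, zero_add, pow_one]

lemma theta_one_five_one_sq {p q : ℂ} (hpq : p ^ 2 = q) (hp0 : p ≠ 0)
    (hp : ‖p‖ < 1) :
    theta 1 5 1 p ^ 2 = theta 0 5 1 q * theta 0 5 0 q - q ^ 2 * (theta 0 5 4 q * theta 0 5 5 q) := by
  have h := theta_mul_theta_parity 1 (A := 5) (C := 1) (D := 0) (by norm_num) (by norm_num)
    (by norm_num) (by norm_num) (by norm_num) (by norm_num) (by norm_num) hp0 hp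
  norm_num [signedPow_one, theta_neg, zpow_ofNat, hpq] at h
  rw [sq, h, ← hpq]
  ring

lemma theta_zero_five_one_sq {p q : ℂ} (hpq : p ^ 2 = q) (hp0 : p ≠ 0)
    (hp : ‖p‖ < 1) :
    theta 0 5 1 p ^ 2 = theta 0 5 1 q * theta 0 5 0 q + q ^ 2 * (theta 0 5 4 q * theta 0 5 5 q) := by
  have h := theta_mul_theta_parity 0 (A := 5) (C := 1) (D := 0) (by norm_num) (by norm_num)
    (by norm_num) (by norm_num) (by norm_num) (by norm_num) (by norm_num) hp0 hp
  norm_num [signedPow_zero, theta_neg, zpow_ofNat, hpq] at h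
  rw [sq, h, ← hpq]
  ring

lemma theta_one_five_three_sq {p q : ℂ} (hpq : p ^ 2 = q) (hp0 : p ≠ 0)
    (hp : ‖p‖ < 1) :
    theta 1 5 3 p ^ 2 = theta 0 5 3 q * theta 0 5 0 q - q * (theta 0 5 2 q * theta 0 5 5 q) := by
  have h := theta_mul_theta_parity 1 (A := 5) (C := 3) (D := 0) (by norm_num) (by norm_num)
    (by norm_num) (by norm_num) (by norm_num) (by norm_num) (by norm_num) hp0 hp
  norm_num [signedPow_one, theta_neg, zpow_ofNat, hpq] at h
  rw [sq, h]
  ring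

lemma theta_one_five_three_mul_theta_one_five_one {p q : ℂ} (hpq : p ^ 2 = q) (hp0 : p ≠ 0)
    (hp : ‖p‖ < 1) :
    theta 1 5 3 p * theta 1 5 1 p =
      theta 0 5 2 q * theta 0 5 1 q - q * (theta 0 5 3 q * theta 0 5 4 q) := by
  have h := theta_mul_theta_parity 1 (A := 5) (C := 2) (D := 1) (by norm_num) (by norm_num)
    (by norm_num) (by norm_num) (by norm_num) (by norm_num) (by norm_num) hp0 hp
  norm_num [signedPow_one, theta_neg, zpow_ofNat, hpq] at h
  rw [h]
  ring

lemma theta_level_one_five_det {p q : ℂ} (hpq : p ^ 2 = q) (hp0 : p ≠ 0)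
    (hp : ‖p‖ < 1) :
    theta 0 1 1 q * theta 0 5 0 q - q * (theta 0 1 0 q * theta 0 5 5 q) =
      2 * (theta 1 5 3 p * theta 1 5 1 p) := by
  have hq : ‖q‖ < 1 := hpq ▸ norm_pow_lt_one hp two_ne_zero
  have h := theta_determinant hp0 hp
  rw [theta_one_three_one hp0 hp, theta_one_three_one (pow_ne_zero 5 hp0)
    (norm_pow_lt_one hp (by norm_num)), pow_right_comm, hpq, qPoch_self_eq_five hq] at h
  rw [h, theta_one_five_one hpq hp0 hp, theta_one_five_three hpq hp0 hp]
  ring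

lemma exists_sqrt {q : ℂ} (hq0 : q ≠ 0) (hq : ‖q‖ < 1) : ∃ p : ℂ, p ^ 2 = q ∧ p ≠ 0 ∧ ‖p‖ < 1 := by
  obtain ⟨p, hp⟩ := IsAlgClosed.exists_pow_nat_eq q two_pos
  refine ⟨p, hp, ?_, ?_⟩
  · rintro rfl
    exact hq0 (by rw [← hp]; simp)
  · rw [← hp, norm_pow] at hq
    exact (pow_lt_one_iff_of_nonneg (norm_nonneg p) two_ne_zero).mp hq

lemma theta_cross_relation_one {q : ℂ} (hq : ‖q‖ < 1) :
    theta 0 5 1 q * (theta 0 1 0 q - theta 0 5 0 q) -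
      q * theta 0 5 4 q * (theta 0 1 1 q - q * theta 0 5 5 q) = 0 := by
  have h10 := differentiableOn_theta 0 (A := 1) (B := 0) (by norm_num) (by norm_num)
  have h11 := differentiableOn_theta 0 (A := 1) (B := 1) (by norm_num) (by norm_num)
  have h50 := differentiableOn_theta 0 (A := 5) (B := 0) (by norm_num) (by norm_num)
  have h51 := differentiableOn_theta 0 (A := 5) (B := 1) (by norm_num) (by norm_num)
  have h54 := differentiableOn_theta 0 (A := 5) (B := 4) (by norm_num) (by norm_num)
  have h55 := differentiableOn_theta 0 (A := 5) (B := 5) (by norm_num) (by norm_num)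
  refine eq_zero_of_mul_eq_zero
    (f := fun q => theta 0 5 1 q * (theta 0 1 0 q - theta 0 5 0 q) -
      q * theta 0 5 4 q * (theta 0 1 1 q - q * theta 0 5 5 q))
    (g := fun q => theta 0 5 1 q * (theta 0 1 0 q + theta 0 5 0 q) +
      q * theta 0 5 4 q * (theta 0 1 1 q + q * theta 0 5 5 q))
    (by fun_prop) (by fun_prop) ?_ (fun q hq0 hq => ?_) hq
  · rw [theta_zero_right 0 (by norm_num), theta_zero_right 0 (by norm_num),
      theta_zero_right 0 (by norm_num)]
    norm_num
  · obtain ⟨p, hpq, hp0, hp⟩ := exists_sqrt hq0 hq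
    have e1 := theta_zero_one_zero_sq hq0 hq
    have e2 := theta_zero_one_one_sq hq0 hq
    have e3 := theta_level_one_five_det hpq hp0 hp
    rw [theta_one_five_three_mul_theta_one_five_one hpq hp0 hp] at e3
    -- The squares in the product are given by `e1` and `e2`, and its mixed terms assemble into the
    -- determinant `e3`.
    linear_combination theta 0 5 1 q ^ 2 * e1 - q ^ 2 * theta 0 5 4 q ^ 2 * e2 -
      2 * q * theta 0 5 1 q * theta 0 5 4 q * e3

lemma theta_cross_relation_two {q : ℂ} (hq : ‖q‖ < 1) :
    theta 0 5 3 q * (theta 0 1 0 q + theta 0 5 0 q) -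
      theta 0 5 2 q * (theta 0 1 1 q + q * theta 0 5 5 q) = 0 := by
  have h10 := differentiableOn_theta 0 (A := 1) (B := 0) (by norm_num) (by norm_num)
  have h11 := differentiableOn_theta 0 (A := 1) (B := 1) (by norm_num) (by norm_num)
  have h50 := differentiableOn_theta 0 (A := 5) (B := 0) (by norm_num) (by norm_num)
  have h52 := differentiableOn_theta 0 (A := 5) (B := 2) (by norm_num) (by norm_num)
  have h53 := differentiableOn_theta 0 (A := 5) (B := 3) (by norm_num) (by norm_num)
  have h55 := differentiableOn_theta 0 (A := 5) (B := 5) (by norm_num) (by norm_num)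
  refine eq_zero_of_mul_eq_zero
    (f := fun q => theta 0 5 3 q * (theta 0 1 0 q + theta 0 5 0 q) -
      theta 0 5 2 q * (theta 0 1 1 q + q * theta 0 5 5 q))
    (g := fun q => theta 0 5 3 q * (theta 0 1 0 q - theta 0 5 0 q) +
      theta 0 5 2 q * (theta 0 1 1 q - q * theta 0 5 5 q))
    (by fun_prop) (by fun_prop) ?_ (fun q hq0 hq => ?_) hq
  · rw [theta_zero_right 0 (by norm_num), theta_zero_right 0 (by norm_num),
      theta_zero_right 0 (by norm_num), theta_zero_right 0 (by norm_num), theta_zero_one_one_zero]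
    norm_num
  · obtain ⟨p, hpq, hp0, hp⟩ := exists_sqrt hq0 hq
    have e1 := theta_zero_one_zero_sq hq0 hq
    have e2 := theta_zero_one_one_sq hq0 hq
    have e3 := theta_level_one_five_det hpq hp0 hp
    rw [theta_one_five_three_mul_theta_one_five_one hpq hp0 hp] at e3
    linear_combination theta 0 5 3 q ^ 2 * e1 - theta 0 5 2 q ^ 2 * e2 +
      2 * theta 0 5 3 q * theta 0 5 2 q * e3

/-! ### The dissection -/

/-- The component of residue `0`. -/
noncomputable def component₀ (q : ℂ) : ℂ :=
  1 / (qPochs [q, q ^ 4] (q ^ 5) ^ 2 * qPochs [q ^ 2, q ^ 8] (q ^ 10))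

/-- The component of residue `2`. -/
noncomputable def component₂ (q : ℂ) : ℂ :=
  1 / (qPochs [q ^ 2, q ^ 3] (q ^ 5) ^ 2 * qPochs [q ^ 2, q ^ 8] (q ^ 10))

/-- The component of residue `3`. -/
noncomputable def component₃ (q : ℂ) : ℂ :=
  2 / (qPochs [q, q ^ 2, q ^ 3, q ^ 4] (q ^ 5) * qPochs [q ^ 4, q ^ 6] (q ^ 10))

/-- The component of residue `4`. -/
noncomputable def component₄ (q : ℂ) : ℂ :=
  -1 / (qPochs [q ^ 2, q ^ 3] (q ^ 5) ^ 2 * qPochs [q ^ 4, q ^ 6] (q ^ 10))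

lemma theta_dissection {p q : ℂ} (hpq : p ^ 2 = q) (hp0 : p ≠ 0) (hp : ‖p‖ < 1) :
    theta 0 5 1 p ^ 2 * theta 1 5 3 q =
      theta 1 5 1 (q ^ 5) * theta 1 5 1 (p ^ 5) ^ 2 +
      q ^ 2 * (theta 1 5 1 (q ^ 5) * theta 1 5 3 (p ^ 5) ^ 2) +
      2 * q ^ 3 * (theta 1 5 3 (q ^ 5) * (theta 1 5 3 (p ^ 5) * theta 1 5 1 (p ^ 5))) -
      q ^ 4 * (theta 1 5 3 (q ^ 5) * theta 1 5 3 (p ^ 5) ^ 2) := by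
  have hq0 : q ≠ 0 := hpq ▸ pow_ne_zero 2 hp0
  have hq : ‖q‖ < 1 := hpq ▸ norm_pow_lt_one hp two_ne_zero
  have hP : (p ^ 5) ^ 2 = q ^ 5 := by rw [← hpq]; ring
  have hP0 : p ^ 5 ≠ 0 := pow_ne_zero 5 hp0
  have hP1 : ‖p ^ 5‖ < 1 := norm_pow_lt_one hp (by norm_num)
  have hQ1 : ‖q ^ 5‖ < 1 := norm_pow_lt_one hq (by norm_num)
  have e0 : theta 0 5 0 q = theta 0 1 0 (q ^ 5) := by rw [theta_pow]; norm_num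
  have e5 : theta 0 5 5 q = theta 0 1 1 (q ^ 5) := by rw [theta_pow]; norm_num
  have d1 := dissection_theta_one hq0 hq
  have d4 := dissection_theta_four hq0 hq
  have x1 := theta_cross_relation_one hQ1
  have x2 := theta_cross_relation_two hQ1
  have s1 := theta_one_five_one_sq hP hP0 hP1
  have s3 := theta_one_five_three_sq hP hP0 hP1
  have s2 := theta_level_one_five_det hP hP0 hP1
  rw [theta_zero_five_one_sq hpq hp0 hp, e0, e5]
  -- By powers of `q` modulo five: residue 0 uses `x1` and `s1`, residues 2 and 4 use `x2` and `s3`,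
  -- residue 3 is the determinant `s2`.
  linear_combination theta 0 1 0 (q ^ 5) * d1 + q ^ 2 * theta 0 1 1 (q ^ 5) * d4 +
    theta 1 5 1 (q ^ 5) * (x1 - s1) - q ^ 2 * theta 1 5 1 (q ^ 5) * (x2 + s3) +
    q ^ 3 * theta 1 5 3 (q ^ 5) * s2 + q ^ 4 * theta 1 5 3 (q ^ 5) * (x2 + s3)

lemma qPoch_pow_ne_zero {q : ℂ} (hq : ‖q‖ < 1) {i j : ℕ} (hi : i ≠ 0) (hj : j ≠ 0) :
    qPoch (q ^ i) (q ^ j) ≠ 0 :=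
  qPoch_ne_zero (norm_pow_lt_one hq hi) (norm_pow_lt_one hq hj)

theorem F_eq_components {q : ℂ} (hq : ‖q‖ < 1) :
    F q = component₀ (q ^ 5) + q ^ 2 * component₂ (q ^ 5) + q ^ 3 * component₃ (q ^ 5) +
      q ^ 4 * component₄ (q ^ 5) := by
  rcases eq_or_ne q 0 with rfl | hq0
  · simp [F, component₀, qPochs, qPoch]
  obtain ⟨p, hpq, hp0, hp⟩ := exists_sqrt hq0 hq
  have hP : (p ^ 5) ^ 2 = q ^ 5 := by rw [← hpq]; ring
  have hP0 : p ^ 5 ≠ 0 := pow_ne_zero 5 hp0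
  have hP1 : ‖p ^ 5‖ < 1 := norm_pow_lt_one hp (by norm_num)
  have h := theta_dissection hpq hp0 hp
  rw [theta_zero_five_one hpq hp0 hp, theta_one_five_three (q := q ^ 2) rfl hq0 hq,
    theta_one_five_one hP hP0 hP1, theta_one_five_three hP hP0 hP1] at h
  have hQ0 : q ^ 5 ≠ 0 := pow_ne_zero 5 hq0
  have hQ : ‖q ^ 5‖ < 1 := norm_pow_lt_one hq (by norm_num)
  have r1 : (q ^ 2) ^ 5 = (q ^ 5) ^ 2 := by ring
  have r2 : (q ^ 2) ^ 4 = q ^ 8 := by ring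
  have hF : F q = (qPoch (-q ^ 2) (q ^ 5) * qPoch (-q ^ 3) (q ^ 5)) ^ 2 *
      (qPoch (q ^ 2) ((q ^ 5) ^ 2) * qPoch (q ^ 8) ((q ^ 5) ^ 2)) := by
    rw [show (q ^ 5) ^ 2 = q ^ 10 by ring]
    simp [F, qPochs]
  rw [r1, r2] at h
  rw [hF]
  generalize qPoch (-q ^ 2) (q ^ 5) = g₁ at *
  generalize qPoch (-q ^ 3) (q ^ 5) = g₂ at *
  generalize qPoch (q ^ 2) ((q ^ 5) ^ 2) = g₃ at *
  generalize qPoch (q ^ 8) ((q ^ 5) ^ 2) = g₄ at *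
  generalize q ^ 5 = Q at *
  rw [theta_one_five_one (q := Q ^ 2) rfl hQ0 hQ, theta_one_five_three (q := Q ^ 2) rfl hQ0 hQ,
    qPoch_self_eq_five hQ, qPoch_self_eq_five (norm_pow_lt_one hQ two_ne_zero)] at h
  simp only [← pow_mul, Nat.reduceMul] at h
  have a1 := qPoch_pow_ne_zero hQ (i := 1) (j := 5) (by norm_num) (by norm_num)
  have a2 := qPoch_pow_ne_zero hQ (i := 2) (j := 5) (by norm_num) (by norm_num)
  have a3 := qPoch_pow_ne_zero hQ (i := 3) (j := 5) (by norm_num) (by norm_num)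
  have a4 := qPoch_pow_ne_zero hQ (i := 4) (j := 5) (by norm_num) (by norm_num)
  have a5 := qPoch_pow_ne_zero hQ (i := 5) (j := 5) (by norm_num) (by norm_num)
  have b1 := qPoch_pow_ne_zero hQ (i := 2) (j := 10) (by norm_num) (by norm_num)
  have b2 := qPoch_pow_ne_zero hQ (i := 4) (j := 10) (by norm_num) (by norm_num)
  have b3 := qPoch_pow_ne_zero hQ (i := 6) (j := 10) (by norm_num) (by norm_num)
  have b4 := qPoch_pow_ne_zero hQ (i := 8) (j := 10) (by norm_num) (by norm_num)
  have b5 := qPoch_pow_ne_zero hQ (i := 10) (j := 10) (by norm_num) (by norm_num)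
  rw [pow_one] at a1
  simp only [component₀, component₂, component₃, component₄, qPochs, List.map_cons, List.map_nil,
    List.prod_cons, List.prod_nil, mul_one]
  generalize qPoch Q (Q ^ 5) = x₁ at *
  generalize qPoch (Q ^ 2) (Q ^ 5) = x₂ at *
  generalize qPoch (Q ^ 3) (Q ^ 5) = x₃ at *
  generalize qPoch (Q ^ 4) (Q ^ 5) = x₄ at *
  generalize qPoch (Q ^ 5) (Q ^ 5) = x₅ at *
  generalize qPoch (Q ^ 2) (Q ^ 10) = y₁ at *
  generalize qPoch (Q ^ 4) (Q ^ 10) = y₂ at *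
  generalize qPoch (Q ^ 6) (Q ^ 10) = y₃ at *
  generalize qPoch (Q ^ 8) (Q ^ 10) = y₄ at *
  generalize qPoch (Q ^ 10) (Q ^ 10) = y₅ at *
  -- Both sides of the theta identity carry the surplus factor `(Q⁵; Q⁵)² (Q¹⁰; Q¹⁰)`.
  have hne : x₅ ^ 2 * y₅ ≠ 0 := mul_ne_zero (pow_ne_zero 2 a5) b5
  field_simp
  apply mul_left_cancel₀ hne
  linear_combination h

/-! ### Power series expansions -/

lemma differentiableOn_qPoch (c : ℂ) (a : ℕ) {b : ℕ} (hb : b ≠ 0) :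
    DifferentiableOn ℂ (fun q => qPoch (c * q ^ a) (q ^ b)) (Metric.ball 0 1) := by
  intro w hw
  rw [mem_ball_zero_iff] at hw
  obtain ⟨r, hwr, hr⟩ := exists_between hw
  have hr0 : 0 ≤ r := (norm_nonneg w).trans hwr.le
  have hu : Summable fun n : ℕ => ‖c‖ * (r ^ b) ^ n :=
    (summable_geometric_of_lt_one (by positivity) (pow_lt_one₀ hr0 hr hb)).mul_left _
  have hprod := hu.hasProdLocallyUniformlyOn_one_add (K := Metric.ball (0 : ℂ) r)
    (f := fun n q => -(c * q ^ a * (q ^ b) ^ n)) Metric.isOpen_ball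
    (Eventually.of_forall fun n q hq => by
      rw [mem_ball_zero_iff] at hq
      rw [norm_neg, norm_mul, norm_mul, norm_pow, norm_pow, norm_pow]
      have h1 : ‖q‖ ^ a ≤ 1 := pow_le_one₀ (norm_nonneg q) (hq.trans hr).le
      gcongr
      exact mul_le_of_le_one_right (norm_nonneg c) h1)
    (fun n => by fun_prop)
  rw [hasProdLocallyUniformlyOn_iff_tendstoLocallyUniformlyOn] at hprod
  have h := hprod.differentiableOn (Eventually.of_forall fun s => by fun_prop) Metric.isOpen_ball
  have heq : (fun q => qPoch (c * q ^ a) (q ^ b)) =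
      fun q => ∏' n : ℕ, (1 + -(c * q ^ a * (q ^ b) ^ n)) := by
    funext q
    simp only [qPoch, sub_eq_add_neg]
  rw [heq]
  exact (h.differentiableAt (Metric.isOpen_ball.mem_nhds
    (mem_ball_zero_iff.mpr hwr))).differentiableWithinAt

lemma differentiableOn_qPoch_pow (a : ℕ) {b : ℕ} (hb : b ≠ 0) :
    DifferentiableOn ℂ (fun q => qPoch (q ^ a) (q ^ b)) (Metric.ball 0 1) := by
  simpa using differentiableOn_qPoch 1 a hb

lemma differentiableOn_F : DifferentiableOn ℂ F (Metric.ball 0 1) := by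
  have h2 := differentiableOn_qPoch (-1) 2 (b := 5) (by norm_num)
  have h3 := differentiableOn_qPoch (-1) 3 (b := 5) (by norm_num)
  have h2' := differentiableOn_qPoch_pow 2 (b := 10) (by norm_num)
  have h8 := differentiableOn_qPoch_pow 8 (b := 10) (by norm_num)
  simp only [neg_one_mul] at h2 h3
  unfold F
  simp only [qPochs, List.map_cons, List.map_nil, List.prod_cons, List.prod_nil, mul_one]
  fun_prop

/-- The components of `F` indexed by the residue modulo five. -/
noncomputable def component : Fin 5 → ℂ → ℂ := ![component₀, 0, component₂, component₃, component₄]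

lemma differentiableOn_component (r : Fin 5) :
    DifferentiableOn ℂ (component r) (Metric.ball 0 1) := by
  have a1 := differentiableOn_qPoch_pow 1 (b := 5) (by norm_num)
  have a2 := differentiableOn_qPoch_pow 2 (b := 5) (by norm_num)
  have a3 := differentiableOn_qPoch_pow 3 (b := 5) (by norm_num)
  have a4 := differentiableOn_qPoch_pow 4 (b := 5) (by norm_num)
  have b2 := differentiableOn_qPoch_pow 2 (b := 10) (by norm_num)
  have b4 := differentiableOn_qPoch_pow 4 (b := 10) (by norm_num)
  have b6 := differentiableOn_qPoch_pow 6 (b := 10) (by norm_num)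
  have b8 := differentiableOn_qPoch_pow 8 (b := 10) (by norm_num)
  simp only [pow_one] at a1
  have ne : ∀ {q : ℂ}, q ∈ Metric.ball (0 : ℂ) 1 → ∀ {i j : ℕ}, i ≠ 0 → j ≠ 0 →
      qPoch (q ^ i) (q ^ j) ≠ 0 := fun hq _ _ hi hj =>
    qPoch_pow_ne_zero (mem_ball_zero_iff.mp hq) hi hj
  have ne1 : ∀ {q : ℂ}, q ∈ Metric.ball (0 : ℂ) 1 → qPoch q (q ^ 5) ≠ 0 := fun hq => by
    simpa using ne hq one_ne_zero (by norm_num : 5 ≠ 0)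
  fin_cases r
  · change DifferentiableOn ℂ component₀ _
    unfold component₀
    simp only [qPochs, List.map_cons, List.map_nil, List.prod_cons, List.prod_nil, mul_one]
    refine DifferentiableOn.fun_div (by fun_prop) (by fun_prop) fun q hq => ?_
    simp [ne1 hq, ne hq]
  · exact differentiableOn_const 0
  · change DifferentiableOn ℂ component₂ _
    unfold component₂
    simp only [qPochs, List.map_cons, List.map_nil, List.prod_cons, List.prod_nil, mul_one]
    refine DifferentiableOn.fun_div (by fun_prop) (by fun_prop) fun q hq => ?_
    simp [ne hq]
  · change DifferentiableOn ℂ component₃ _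
    unfold component₃
    simp only [qPochs, List.map_cons, List.map_nil, List.prod_cons, List.prod_nil, mul_one]
    refine DifferentiableOn.fun_div (by fun_prop) (by fun_prop) fun q hq => ?_
    simp [ne1 hq, ne hq]
  · change DifferentiableOn ℂ component₄ _
    unfold component₄
    simp only [qPochs, List.map_cons, List.map_nil, List.prod_cons, List.prod_nil, mul_one]
    refine DifferentiableOn.fun_div (by fun_prop) (by fun_prop) fun q hq => ?_
    simp [ne hq]

lemma hasSum_taylor {f : ℂ → ℂ} (hf : DifferentiableOn ℂ f (Metric.ball 0 1)) {q : ℂ}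
    (hq : ‖q‖ < 1) :
    HasSum (fun n : ℕ => iteratedDeriv n f 0 / (n.factorial : ℂ) * q ^ n) (f q) := by
  refine (congrArg (HasSum · _) (funext fun n => ?_)).mpr
    (Complex.hasSum_taylorSeries_on_ball hf (mem_ball_zero_iff.mpr hq))
  simp only [sub_zero, smul_eq_mul]
  ring

lemma coeff_unique {c d : ℕ → ℂ} {f : ℂ → ℂ}
    (hc : ∀ q : ℂ, ‖q‖ < 1 → HasSum (fun n => c n * q ^ n) (f q))
    (hd : ∀ q : ℂ, ‖q‖ < 1 → HasSum (fun n => d n * q ^ n) (f q)) : c = d := by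
  have key : ∀ {c : ℕ → ℂ}, (∀ q : ℂ, ‖q‖ < 1 → HasSum (fun n => c n * q ^ n) (f q)) →
      HasFPowerSeriesAt f (FormalMultilinearSeries.ofScalars ℂ c) 0 := fun {c} hc => by
    rw [hasFPowerSeriesAt_iff]
    filter_upwards [Metric.isOpen_ball.mem_nhds (Metric.mem_ball_self one_pos)] with q hq
    simpa [FormalMultilinearSeries.coeff_ofScalars, mul_comm] using hc q (mem_ball_zero_iff.mp hq)
  have h := (key hc).eq_formalMultilinearSeries (key hd)
  funext n
  simpa [FormalMultilinearSeries.coeff_ofScalars] using congrArg (fun s => s.coeff n) h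

/-- Each progression is extended by zero to all of `ℕ`, and the five series are added termwise, so
summability of `f` need not be known beforehand. -/
lemma hasSum_of_residues {f : ℕ → ℂ} {a : Fin 5 → ℂ}
    (h : ∀ r : Fin 5, HasSum (fun n => f (5 * n + r)) (a r)) : HasSum f (∑ r, a r) := by
  have h1 : ∀ r : Fin 5, HasSum (fun n => if n % 5 = (r : ℕ) then f n else 0) (a r) := fun r => by
    have hinj : Function.Injective fun n : ℕ => 5 * n + (r : ℕ) := fun x y hxy => by
      simp only at hxy; omega
    rw [← hinj.hasSum_iff]
    · refine (congrArg (HasSum · _) (funext fun n => ?_)).mpr (h r)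
      have : (5 * n + (r : ℕ)) % 5 = r := by omega
      simp [this]
    · intro n hn
      rw [if_neg]
      intro hr
      exact hn ⟨n / 5, by simp only; omega⟩
  refine (congrArg (HasSum · _) (funext fun n => ?_)).mpr (hasSum_sum fun r _ => h1 r)
  have hlt : n % 5 < 5 := Nat.mod_lt _ (by norm_num)
  rw [Finset.sum_eq_single (⟨n % 5, hlt⟩ : Fin 5)]
  · simp
  · intro r _ hr
    rw [if_neg]
    exact fun hn => hr (Fin.ext hn.symm)
  · simp

lemma hasSum_F {q : ℂ} (hq : ‖q‖ < 1) : HasSum (fun n : ℕ => h₁ n * q ^ n) (F q) :=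
  hasSum_taylor differentiableOn_F hq

lemma h₁_eq_component_coeff (r : Fin 5) (n : ℕ) :
    h₁ (5 * n + r) = iteratedDeriv n (component r) 0 / (n.factorial : ℂ) := by
  -- Interleaved Taylor coefficients of the components; they also expand `F`, so uniqueness gives
  -- `h₁ = c`.
  set c : ℕ → ℂ := fun m =>
    iteratedDeriv (m / 5) (component (Fin.ofNat 5 m)) 0 / ((m / 5).factorial : ℂ) with hc
  have hcr : ∀ (r : Fin 5) (n : ℕ), c (5 * n + r) =
      iteratedDeriv n (component r) 0 / (n.factorial : ℂ) := fun r n => by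
    have e1 : (5 * n + (r : ℕ)) / 5 = n := by omega
    have e2 : Fin.ofNat 5 (5 * n + (r : ℕ)) = r := Fin.ext (by simp [Fin.ofNat])
    simp only [hc, e1, e2]
  have h : h₁ = c := by
    refine coeff_unique (f := F) (fun q hq => hasSum_F hq) fun q hq => ?_
    have hs := hasSum_of_residues (f := fun m => c m * q ^ m)
      (a := fun r => component r (q ^ 5) * q ^ (r : ℕ)) fun r => by
        refine (congrArg (HasSum · _) (funext fun n => ?_)).mpr ((hasSum_taylor
          (differentiableOn_component r) (norm_pow_lt_one hq (by norm_num))).mul_right (q ^ (r : ℕ)))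
        rw [hcr, pow_add, pow_mul]
        ring
    convert hs using 1
    rw [F_eq_components hq, Fin.sum_univ_five]
    simp [component]
    ring
  rw [h, hcr]

lemma hasSum_component (r : Fin 5) {q : ℂ} (hq : ‖q‖ < 1) :
    HasSum (fun n : ℕ => h₁ (5 * n + r) * q ^ n) (component r q) := by
  simpa only [h₁_eq_component_coeff] using hasSum_taylor (differentiableOn_component r) hq

lemma H_eq_component (r : Fin 5) {q : ℂ} (hq : ‖q‖ < 1) : H r q = component r q :=
  (hasSum_component r hq).tsum_eq

end QDissection

theorem mainTheorem2 :
    -- `h₁` is the coefficient sequence: `F(q) = ∑ h₁(n) q ^ n` on the open unit disc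
    (∀ q : ℂ, ‖q‖ < 1 → HasSum (fun n : ℕ => QDissection.h₁ n * q ^ n) (QDissection.F q)) ∧
    -- each series `H_r` converges on the open unit disc
    (∀ r : ℕ, r < 5 → ∀ q : ℂ, ‖q‖ < 1 →
      HasSum (fun n : ℕ => QDissection.h₁ (5 * n + r) * q ^ n) (QDissection.H r q)) ∧
    -- the 5-dissection
    (∀ q : ℂ, ‖q‖ < 1 →
      QDissection.qPochs [-q ^ 2, -q ^ 3] (q ^ 5) ^ 2 * QDissection.qPochs [q ^ 2, q ^ 8] (q ^ 10) =
        QDissection.H 0 (q ^ 5) + q ^ 2 * QDissection.H 2 (q ^ 5) +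
          q ^ 3 * QDissection.H 3 (q ^ 5) + q ^ 4 * QDissection.H 4 (q ^ 5)) ∧
    -- the component of residue 1 vanishes
    (∀ n : ℕ, QDissection.h₁ (5 * n + 1) = 0) ∧
    -- the product formulas for the components
    (∀ q : ℂ, ‖q‖ < 1 →
      QDissection.H 0 q =
        1 / (QDissection.qPochs [q, q ^ 4] (q ^ 5) ^ 2 *
          QDissection.qPochs [q ^ 2, q ^ 8] (q ^ 10)) ∧
      QDissection.H 2 q =
        1 / (QDissection.qPochs [q ^ 2, q ^ 3] (q ^ 5) ^ 2 *
          QDissection.qPochs [q ^ 2, q ^ 8] (q ^ 10)) ∧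
      QDissection.H 3 q =
        2 / (QDissection.qPochs [q, q ^ 2, q ^ 3, q ^ 4] (q ^ 5) *
          QDissection.qPochs [q ^ 4, q ^ 6] (q ^ 10)) ∧
      QDissection.H 4 q =
        -1 / (QDissection.qPochs [q ^ 2, q ^ 3] (q ^ 5) ^ 2 *
          QDissection.qPochs [q ^ 4, q ^ 6] (q ^ 10))) := by
  refine ⟨fun q hq => QDissection.hasSum_F hq, fun r hr q hq => ?_, fun q hq => ?_, fun n => ?_,
    fun q hq => ⟨QDissection.H_eq_component 0 hq, QDissection.H_eq_component 2 hq,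
      QDissection.H_eq_component 3 hq, QDissection.H_eq_component 4 hq⟩⟩
  · exact (QDissection.hasSum_component ⟨r, hr⟩ hq).summable.hasSum
  · have hq5 : ‖q ^ 5‖ < 1 := QDissection.norm_pow_lt_one hq (by norm_num)
    have h0 : QDissection.H 0 (q ^ 5) = _ := QDissection.H_eq_component 0 hq5
    have h2 : QDissection.H 2 (q ^ 5) = _ := QDissection.H_eq_component 2 hq5
    have h3 : QDissection.H 3 (q ^ 5) = _ := QDissection.H_eq_component 3 hq5
    have h4 : QDissection.H 4 (q ^ 5) = _ := QDissection.H_eq_component 4 hq5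
    rw [h0, h2, h3, h4]
    exact QDissection.F_eq_components hq
  · have h := QDissection.h₁_eq_component_coeff 1 n
    have hz : QDissection.component 1 = fun _ => 0 := rfl
    rw [hz, iteratedDeriv_const] at h
    simpa using h
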